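/- All graphs are finite and simple. For a graph $G$ let $Q(G)=D(G)+A(G)$ be its signless Laplacian (degree matrix plus adjacency matrix), let $q_{\min}(G)$ be the least eigenvalue of $Q(G)$, and let $\gamma(G)$ be the domination number of $G$. For odd $g$ with $3\le g\le n-1$ and $1\le k\le n-g$, let $U_n^k(g)$ be the graph of order $n$ obtained from a cycle $C_g$ and a star $S_{1,k}$ with $k$ leaves by joining one vertex of the cycle to the center of the star by a path $P_l$ on $l=n+1-g-k$ vertices, whose end vertices are that cycle vertex and the center (if $l=1$, these two are identified). Put $\gamma_g=\gamma(U_n^1(g))$. For each integer $\gamma$ with $\lceil g/3\rceil\le\gamma\le\gamma_g$ there is at least one $k\in\{1,\dots,n-g\}$ with $\gamma(U_n^k(g))=\gamma$; let $V_n^\gamma(g)$ be the graph $U_n^k(g)$ with the smallest such $k$. Then, for fixed $n$ and $\gamma$, the least $Q$-eigenvalue of $V_n^\gamma(g)$ is strictly increasing in odd $g$: if $g_1<g_2$ are odd integers in $[3,n-1]$ with $\lceil g_i/3\rceil\le\gamma\le\gamma_{g_i}$ for $i=1,2$, then $$q_{\min}(V_n^\gamma(g_1))<q_{\min}(V_n^\gamma(g_2)).$$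 -/

import Mathlib

namespace LeastQ

open Classical in
/-- The signless Laplacian `Q(G) = D(G) + A(G)`, as a real matrix. -/
noncomputable def signlessLaplacian {V : Type*} [Fintype V] (G : SimpleGraph V) :
    Matrix V V ℝ :=
  Matrix.diagonal (fun v => (G.degree v : ℝ)) + G.adjMatrix ℝ

/-- The least eigenvalue of the signless Laplacian. For a nonempty vertex type the set of real
eigenvalues of this symmetric matrix is finite and nonempty, so the infimum is its minimum. -/
noncomputable def qMin {V : Type*} [Fintype V] (G : SimpleGraph V) : ℝ :=
  sInf {μ : ℝ | ∃ x : V → ℝ, x ≠ 0 ∧ (signlessLaplacian G).mulVec x = μ • x}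

/-- Every vertex outside `S` is adjacent to at least one vertex of `S`. -/
def IsDominating {V : Type*} (G : SimpleGraph V) (S : Finset V) : Prop :=
  ∀ v, v ∉ S → ∃ u ∈ S, G.Adj v u

/-- The minimum cardinality of a dominating set (the whole vertex set is one). -/
noncomputable def dominationNumber {V : Type*} [Fintype V] (G : SimpleGraph V) : ℕ :=
  sInf {m : ℕ | ∃ S : Finset V, IsDominating G S ∧ S.card = m}

/-- The graph `U_n^k(g)`, meant for odd `3 ≤ g < n` and `1 ≤ k ≤ n - g`: the vertices
`0, …, g - 1` form a cycle `C_g`; the vertices `g - 1, g, …, n - 1 - k` form a path with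
`n + 1 - g - k` vertices starting at the cycle vertex `g - 1`; its last vertex `n - 1 - k` is the
center of a star whose `k` leaves are `n - k, …, n - 1`. -/
def unicyclicGraph (n g k : ℕ) : SimpleGraph (Fin n) :=
  SimpleGraph.fromRel fun i j =>
    -- consecutive vertices on the cycle and on the path
    ((i : ℕ) + 1 = j ∧ (j : ℕ) + k + 1 ≤ n) ∨
    -- the edge that closes the cycle
    ((i : ℕ) = 0 ∧ (j : ℕ) + 1 = g) ∨
    -- the edges from the center of the star to its leaves
    ((i : ℕ) + k + 1 = n ∧ n ≤ (j : ℕ) + k)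

/-- The admissible `k` for which `U_n^k(g)` has domination number `γ`. -/
def pendantCounts (n γ g : ℕ) : Set ℕ :=
  {k : ℕ | 1 ≤ k ∧ g + k ≤ n ∧ dominationNumber (unicyclicGraph n g k) = γ}

/-- The graph `V_n^γ(g)`: the graph `U_n^k(g)` with domination number `γ` and with the smallest
such `k`. -/
noncomputable def minUnicyclicGraph (n γ g : ℕ) : SimpleGraph (Fin n) :=
  unicyclicGraph n g (sInf (pendantCounts n γ g))

/-- The odd girths `g` with `3 ≤ g ≤ n - 1` and `⌈g / 3⌉ ≤ γ ≤ γ_g`, where `γ_g` is the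
domination number of `U_n^1(g)`: those for which `V_n^γ(g)` is considered. -/
def admissibleGirths (n γ : ℕ) : Set ℕ :=
  {g : ℕ | Odd g ∧ 3 ≤ g ∧ g < n ∧ ⌈(g : ℚ) / 3⌉₊ ≤ γ ∧
    γ ≤ dominationNumber (unicyclicGraph n g 1)}

end LeastQ

/-!
The proof compares Rayleigh quotients and never computes an eigenvalue. Let `g = 2h + 1`.

The least eigenvalue of `Q` is the minimum of `∑ (x u + x v) ^ 2` over the edges, for unit vectors
`x`. On `U_n^k(g)` the minimum is attained at a vector that is symmetric about the axis of the
cycle (`exists_foldedForm_eq`). After alternating signs are removed, such a vector is a sequence `y`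
that starts at the edge of the cycle farthest from the star; that edge contributes `4 * y 0 ^ 2`,
and every other edge contributes the square of a difference. Replacing `|y|` by its running maximum
shows that `y` may be taken nonnegative and nondecreasing towards the leaves
(`exists_monotone_foldedForm_eq`). Two transplantations of such a minimizer then give

* `q(U_n^k(g)) ≤ q(U_n^{k+1}(g))`: a leaf becomes the new center and takes over the other leaves
  (`qMin_unicyclicGraph_le_succ`);
* `q(U_n^{k+1}(g)) < q(U_n^k(g + 2))`: the two neighbors of the branching vertex on the cycle are
  identified, and the vertex that this saves becomes a leaf (`qMin_unicyclicGraph_succ_lt`).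

Together they give `q(U_n^{k₁}(g₁)) < q(U_n^{k₂}(g₂))` whenever `g₁ < g₂` are odd and
`k₁ ≤ k₂ + 1`. The least `k` with domination number `γ` satisfies the latter condition
(`sInf_pendantCounts_le`), because the domination number of `U_n^k(g)` is always between
`⌈(n - k) / 3⌉` and `⌈(n - k + 1) / 3⌉`. That such a `k` exists is a discrete intermediate value
argument: the domination number drops by at most one when `k` grows by one.
-/

namespace LeastQ
open Finset

/-! ### The domination number of `U_n^k(g)` -/

/-- Every third vertex of the path from the center `c` of the star back to the vertex `0` dominates
the graph. The truncated subtraction turns a last step beyond the end of the path into the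
vertex `0`. -/
theorem dominationNumber_unicyclicGraph_le {n g k c : ℕ} (hn : c + 1 + k = n) :
    dominationNumber (unicyclicGraph n g k) ≤ (c + 4) / 3 := by
  classical
  let S : Finset (Fin n) := (range ((c + 4) / 3)).image fun j => ⟨c - 3 * j, by omega⟩
  have hS : IsDominating (unicyclicGraph n g k) S := by
    intro v hv
    by_cases hvc : (v : ℕ) ≤ c
    · have hmem : (⟨c - 3 * ((c - v + 1) / 3), by omega⟩ : Fin n) ∈ S :=
        mem_image.2 ⟨(c - v + 1) / 3, by simp only [mem_range]; omega, rfl⟩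
      have hne : v ≠ ⟨c - 3 * ((c - v + 1) / 3), by omega⟩ := fun h => hv (h ▸ hmem)
      refine ⟨_, hmem, ?_⟩
      rw [unicyclicGraph, SimpleGraph.fromRel_adj]
      refine ⟨hne, ?_⟩
      have hne' : (v : ℕ) ≠ c - 3 * ((c - v + 1) / 3) := fun h => hne (Fin.ext h)
      dsimp only
      omega
    · refine ⟨⟨c, by omega⟩, mem_image.2 ⟨0, by simp, by simp⟩, ?_⟩
      rw [unicyclicGraph, SimpleGraph.fromRel_adj]
      refine ⟨fun h => hvc (by rw [h]), ?_⟩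
      dsimp only
      omega
  calc dominationNumber (unicyclicGraph n g k) ≤ S.card := Nat.sInf_le ⟨S, hS, rfl⟩
    _ ≤ (range ((c + 4) / 3)).card := card_image_le
    _ = (c + 4) / 3 := card_range _

/-- If the center of the star lies on the cycle, every third vertex of the cycle suffices, one of
them being the center. -/
theorem dominationNumber_unicyclicGraph_star_le {n g : ℕ} (hg : 3 ≤ g) (hn : g < n) :
    dominationNumber (unicyclicGraph n g (n - g)) ≤ (g + 2) / 3 := by
  classical
  let S : Finset (Fin n) :=
    (range ((g + 2) / 3)).image fun j => ⟨min (3 * j + 2) (g - 1), by omega⟩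
  have hlast : (⟨g - 1, by omega⟩ : Fin n) ∈ S :=
    mem_image.2 ⟨(g + 2) / 3 - 1, by simp only [mem_range]; omega, by
      apply Fin.ext; dsimp only; omega⟩
  have hS : IsDominating (unicyclicGraph n g (n - g)) S := by
    intro v hv
    have hne0 : (v : ℕ) ≠ g - 1 := fun h => hv (by
      have : v = ⟨g - 1, by omega⟩ := Fin.ext h
      rw [this]; exact hlast)
    by_cases hvc : (v : ℕ) = 0 ∨ g ≤ v
    · refine ⟨_, hlast, ?_⟩
      rw [unicyclicGraph, SimpleGraph.fromRel_adj]
      refine ⟨fun h => hne0 (by rw [h]), ?_⟩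
      dsimp only
      omega
    · have hmem : (⟨min (3 * (((v : ℕ) - 1) / 3) + 2) (g - 1), by omega⟩ : Fin n) ∈ S :=
        mem_image.2 ⟨((v : ℕ) - 1) / 3, by simp only [mem_range]; omega, rfl⟩
      have hne : v ≠ ⟨min (3 * (((v : ℕ) - 1) / 3) + 2) (g - 1), by omega⟩ := fun h => hv (h ▸ hmem)
      refine ⟨_, hmem, ?_⟩
      rw [unicyclicGraph, SimpleGraph.fromRel_adj]
      refine ⟨hne, ?_⟩
      have hne' : (v : ℕ) ≠ min (3 * (((v : ℕ) - 1) / 3) + 2) (g - 1) := fun h => hne (Fin.ext h)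
      dsimp only
      omega
  calc dominationNumber (unicyclicGraph n g (n - g)) ≤ S.card := Nat.sInf_le ⟨S, hS, rfl⟩
    _ ≤ (range ((g + 2) / 3)).card := card_image_le
    _ = (g + 2) / 3 := card_range _

theorem exists_isDominating_card {V : Type*} [Fintype V] (G : SimpleGraph V) :
    ∃ S : Finset V, IsDominating G S ∧ S.card = dominationNumber G :=
  Nat.sInf_mem (s := {m : ℕ | ∃ S : Finset V, IsDominating G S ∧ S.card = m})
    ⟨_, univ, fun v hv => absurd (mem_univ v) hv, rfl⟩

/-- Turning one leaf into the new center of the star costs at most one more dominating vertex,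
namely the new center. -/
theorem dominationNumber_unicyclicGraph_le_succ {n g k : ℕ} (hn : g + (k + 1) ≤ n) :
    dominationNumber (unicyclicGraph n g k) ≤
      dominationNumber (unicyclicGraph n g (k + 1)) + 1 := by
  classical
  obtain ⟨S, hS, hcard⟩ := exists_isDominating_card (unicyclicGraph n g (k + 1))
  rw [← hcard]
  let c : Fin n := ⟨n - 1 - k, by omega⟩
  refine le_trans (Nat.sInf_le ⟨insert c S, ?_, rfl⟩) (card_insert_le _ _)
  intro v hv
  simp only [mem_insert, not_or] at hv
  have hvc : (v : ℕ) ≠ n - 1 - k := fun h => hv.1 (Fin.ext h)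
  by_cases hvd : (v : ℕ) + 1 = n - 1 - k ∨ n - 1 - k < v
  · refine ⟨c, mem_insert_self _ _, ?_⟩
    rw [unicyclicGraph, SimpleGraph.fromRel_adj]
    refine ⟨hv.1, ?_⟩
    simp only [c]
    omega
  · obtain ⟨u, hu, hadj⟩ := hS v hv.2
    refine ⟨u, mem_insert_of_mem hu, ?_⟩
    rw [unicyclicGraph, SimpleGraph.fromRel_adj] at hadj ⊢
    refine ⟨hadj.1, ?_⟩
    have := hadj.2
    omega

/-- Every vertex of a dominating set covers at most three vertices off the leaves, with one
exception on either side: the branching vertex of the cycle may cover four, and the center of the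
star (or a leaf, one of which must be present) covers at most two. The two corrections cancel. -/
theorem le_dominationNumber_unicyclicGraph {n g k : ℕ} (hg : 3 ≤ g) (hk : 1 ≤ k)
    (hn : g + k ≤ n) : n - k ≤ 3 * dominationNumber (unicyclicGraph n g k) := by
  classical
  obtain ⟨S, hS, hcard⟩ := exists_isDominating_card (unicyclicGraph n g k)
  rw [← hcard]
  let N : Fin n → Finset ℕ := fun s =>
    (range (n - k)).filter fun j => j = s ∨ ∃ hj : j < n, (unicyclicGraph n g k).Adj ⟨j, hj⟩ s
  have hcov : range (n - k) ⊆ S.biUnion N := by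
    intro j hj
    have hjn : j < n := by have := mem_range.1 hj; omega
    by_cases hjS : (⟨j, hjn⟩ : Fin n) ∈ S
    · exact mem_biUnion.2 ⟨_, hjS, mem_filter.2 ⟨hj, Or.inl rfl⟩⟩
    · obtain ⟨u, hu, hadj⟩ := hS _ hjS
      exact mem_biUnion.2 ⟨u, hu, mem_filter.2 ⟨hj, Or.inr ⟨hjn, hadj⟩⟩⟩
  have hN : ∀ s : Fin n, (N s).card + (if n ≤ (s : ℕ) + k + 1 then 1 else 0)
      ≤ 3 + if (s : ℕ) + 1 = g then 1 else 0 := by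
    intro s
    have hmem : ∀ j ∈ N s, j < n - k ∧ (j = s ∨
        ((j + 1 = s ∧ s + k + 1 ≤ n) ∨ (j = 0 ∧ (s : ℕ) + 1 = g) ∨ (j + k + 1 = n ∧ n ≤ s + k)) ∨
        ((s + 1 = j ∧ j + k + 1 ≤ n) ∨ ((s : ℕ) = 0 ∧ j + 1 = g) ∨
          (s + k + 1 = n ∧ n ≤ j + k))) := by
      intro j hj
      obtain ⟨h1, h2⟩ := mem_filter.1 hj
      refine ⟨mem_range.1 h1, ?_⟩
      rcases h2 with h2 | ⟨hjn, h2⟩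
      · exact Or.inl h2
      · rw [unicyclicGraph, SimpleGraph.fromRel_adj] at h2
        exact Or.inr h2.2
    -- an explicit superset in each of the possible positions of `s`
    have hsub : ∀ T : Finset ℕ, (∀ j ∈ N s, j ∈ T) → (N s).card ≤ T.card :=
      fun T hT => card_le_card hT
    by_cases h1 : n ≤ (s : ℕ) + k
    · have := hsub {n - 1 - k} fun j hj => by
        have := hmem j hj
        simp only [mem_singleton]
        omega
      rw [card_singleton] at this
      split_ifs <;> omega
    by_cases h2 : (s : ℕ) + 1 = g
    · by_cases h3 : n ≤ (s : ℕ) + k + 1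
      · have := hsub {(s : ℕ) - 1, (s : ℕ), 0} fun j hj => by
          have := hmem j hj
          simp only [mem_insert, mem_singleton]
          omega
        have h4 := this.trans card_le_three
        rw [if_pos h3, if_pos h2]
        omega
      · have := hsub {(s : ℕ) - 1, (s : ℕ), 0, (s : ℕ) + 1} fun j hj => by
          have := hmem j hj
          simp only [mem_insert, mem_singleton]
          omega
        have h4 := this.trans card_le_four
        rw [if_neg h3, if_pos h2]
        omega
    · by_cases h3 : n ≤ (s : ℕ) + k + 1
      · have := hsub {(s : ℕ) - 1, (s : ℕ)} fun j hj => by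
          have := hmem j hj
          simp only [mem_insert, mem_singleton]
          omega
        have h4 := this.trans card_le_two
        rw [if_pos h3, if_neg h2]
        omega
      · by_cases h5 : (s : ℕ) = 0
        · have := hsub {g - 1, (s : ℕ), (s : ℕ) + 1} fun j hj => by
            have := hmem j hj
            simp only [mem_insert, mem_singleton]
            omega
          have h4 := this.trans card_le_three
          rw [if_neg h3, if_neg h2]
          omega
        · have := hsub {(s : ℕ) - 1, (s : ℕ), (s : ℕ) + 1} fun j hj => by
            have := hmem j hj
            simp only [mem_insert, mem_singleton]
            omega
          have h4 := this.trans card_le_three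
          rw [if_neg h3, if_neg h2]
          omega
  have hsum := sum_le_sum fun s (_ : s ∈ S) => hN s
  rw [sum_add_distrib, sum_add_distrib] at hsum
  -- a leaf is dominated only by itself or by the center
  have hleaf : 1 ≤ ∑ s ∈ S, if n ≤ (s : ℕ) + k + 1 then 1 else 0 := by
    have : ∃ u ∈ S, n ≤ (u : ℕ) + k + 1 := by
      by_cases hl : (⟨n - 1, by omega⟩ : Fin n) ∈ S
      · exact ⟨_, hl, by dsimp only; omega⟩
      · obtain ⟨u, hu, hadj⟩ := hS _ hl
        refine ⟨u, hu, ?_⟩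
        rw [unicyclicGraph, SimpleGraph.fromRel_adj] at hadj
        have := hadj.2
        dsimp only at this
        omega
    obtain ⟨u, hu, h⟩ := this
    calc 1 = if n ≤ (u : ℕ) + k + 1 then 1 else 0 := (if_pos h).symm
      _ ≤ _ := single_le_sum (f := fun s : Fin n => if n ≤ (s : ℕ) + k + 1 then 1 else 0)
        (fun _ _ => Nat.zero_le _) hu
  have hbranch : (∑ s ∈ S, if (s : ℕ) + 1 = g then 1 else 0) ≤ 1 := by
    rw [sum_boole, Nat.cast_id, card_le_one]
    intro a ha b hb
    have ha := (mem_filter.1 ha).2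
    have hb := (mem_filter.1 hb).2
    exact Fin.ext (by omega)
  have hc := (card_le_card hcov).trans card_biUnion_le
  rw [card_range] at hc
  rw [sum_const, smul_eq_mul] at hsum
  omega

/-- The domination number drops by at most one when `k` grows by one, so that the values between
its extremes are all taken, and they are taken as soon as the number has dropped far enough. -/
theorem exists_mem_pendantCounts_le {n γ g K : ℕ} (hg : g ∈ admissibleGirths n γ) (hK : 1 ≤ K)
    (hKn : g + K ≤ n) (hKγ : dominationNumber (unicyclicGraph n g K) ≤ γ) :
    ∃ k ∈ pendantCounts n γ g, k ≤ K := by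
  induction K, hK using Nat.le_induction with
  | base => exact ⟨1, ⟨le_rfl, hKn, le_antisymm hKγ hg.2.2.2.2⟩, le_rfl⟩
  | succ K hK ih =>
    by_cases h : dominationNumber (unicyclicGraph n g K) ≤ γ
    · obtain ⟨k, hk, hkK⟩ := ih (by omega) h
      exact ⟨k, hk, by omega⟩
    · have := dominationNumber_unicyclicGraph_le_succ hKn
      exact ⟨K + 1, ⟨by omega, hKn, by omega⟩, le_rfl⟩

theorem pendantCounts_nonempty {n γ g : ℕ} (hg : g ∈ admissibleGirths n γ) :
    (pendantCounts n γ g).Nonempty := by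
  have h := hg
  obtain ⟨-, h3, hn, hγ, -⟩ := h
  have hγ' : (g + 2) / 3 ≤ γ := by
    have h1 : (g : ℚ) / 3 ≤ (γ : ℚ) := (Nat.le_ceil _).trans (by exact_mod_cast hγ)
    have h2 : (g : ℚ) ≤ (3 * γ : ℕ) := by push_cast; linarith
    have h3 : g ≤ 3 * γ := by exact_mod_cast h2
    omega
  obtain ⟨k, hk, -⟩ := exists_mem_pendantCounts_le hg (K := n - g) (by omega) (by omega)
    ((dominationNumber_unicyclicGraph_star_le h3 hn).trans hγ')
  exact ⟨k, hk⟩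

/-- The domination number of `U_n^k(g)` lies between `⌈(n - k) / 3⌉` and `⌈(n - k + 1) / 3⌉` for
every `g`, so the least admissible `k` hardly depends on `g`. -/
theorem sInf_pendantCounts_le {n γ g₁ g₂ : ℕ} (h₁ : g₁ ∈ admissibleGirths n γ)
    (h₂ : g₂ ∈ admissibleGirths n γ) (h : g₁ < g₂) :
    sInf (pendantCounts n γ g₁) ≤ sInf (pendantCounts n γ g₂) + 1 := by
  obtain ⟨hk, hkn, hγ⟩ := Nat.sInf_mem (pendantCounts_nonempty h₂)
  set k := sInf (pendantCounts n γ g₂)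
  have hlow := le_dominationNumber_unicyclicGraph h₂.2.1 hk hkn
  have hup := dominationNumber_unicyclicGraph_le (n := n) (g := g₁) (k := k + 1)
    (c := n - k - 2) (by have := h₁.2.1; omega)
  obtain ⟨k', hk', hle⟩ := exists_mem_pendantCounts_le h₁ (K := k + 1) (by omega) (by omega)
    (by omega)
  exact (Nat.sInf_le hk').trans hle

/-! ### The least eigenvalue as a minimum of Rayleigh quotients -/

theorem signlessLaplacian_isHermitian {V : Type*} [Fintype V] (G : SimpleGraph V) :
    (signlessLaplacian G).IsHermitian := by
  classical
  unfold signlessLaplacian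
  refine Matrix.IsHermitian.add (Matrix.isHermitian_diagonal _) ?_
  ext i j
  simp [SimpleGraph.adjMatrix_apply, G.adj_comm]

open Classical in
theorem dotProduct_signlessLaplacian {V : Type*} [Fintype V] (G : SimpleGraph V) (x : V → ℝ) :
    2 * (x ⬝ᵥ (signlessLaplacian G).mulVec x)
      = ∑ i, ∑ j, if G.Adj i j then (x i + x j) ^ 2 else 0 := by
  have h1 : x ⬝ᵥ (signlessLaplacian G).mulVec x
      = ∑ i, ∑ j, if G.Adj i j then x i ^ 2 + x i * x j else 0 := by
    simp only [dotProduct]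
    refine sum_congr rfl fun i _ => ?_
    have hd : (G.degree i : ℝ) = ∑ j, if G.Adj i j then (1 : ℝ) else 0 := by
      rw [Finset.sum_boole, ← SimpleGraph.card_neighborFinset_eq_degree,
        SimpleGraph.neighborFinset_eq_filter]
    rw [signlessLaplacian, Matrix.add_mulVec, Pi.add_apply, Matrix.mulVec_diagonal, hd,
      Matrix.mulVec, dotProduct, sum_mul, ← sum_add_distrib, mul_sum]
    refine sum_congr rfl fun j _ => ?_
    rw [SimpleGraph.adjMatrix_apply]
    split_ifs <;> ring
  have h2 : ∑ i, ∑ j, (if G.Adj i j then x i ^ 2 + x i * x j else 0)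
      = ∑ i, ∑ j, if G.Adj i j then x j ^ 2 + x i * x j else 0 := by
    rw [sum_comm]
    refine sum_congr rfl fun i _ => sum_congr rfl fun j _ => ?_
    simp only [G.adj_comm, mul_comm]
  rw [h1, two_mul]
  nth_rewrite 2 [h2]
  rw [← sum_add_distrib]
  refine sum_congr rfl fun i _ => ?_
  rw [← sum_add_distrib]
  refine sum_congr rfl fun j _ => ?_
  split_ifs <;> ring

/-- The least eigenvalue of `Q(G)` is attained, and it is a lower bound of the Rayleigh quotient. -/
theorem qMin_spec {V : Type*} [Fintype V] [Nonempty V] (G : SimpleGraph V) :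
    (∃ x : V → ℝ, x ≠ 0 ∧ x ⬝ᵥ (signlessLaplacian G).mulVec x = qMin G * (x ⬝ᵥ x)) ∧
      ∀ x : V → ℝ, qMin G * (x ⬝ᵥ x) ≤ x ⬝ᵥ (signlessLaplacian G).mulVec x := by
  classical
  set Q := signlessLaplacian G with hQdef
  have hQ : Q.IsHermitian := signlessLaplacian_isHermitian G
  obtain ⟨i, hi⟩ := Finite.exists_min hQ.eigenvalues
  set μ := hQ.eigenvalues i with hμ
  have hps : (Q - algebraMap ℝ (Matrix V V ℝ) μ).PosSemidef := by
    rw [Matrix.posSemidef_iff_isHermitian_and_spectrum_nonneg]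
    refine ⟨hQ.sub ?_, ?_⟩
    · rw [Matrix.algebraMap_eq_diagonal]
      exact Matrix.isHermitian_diagonal _
    · intro t ht
      rw [← spectrum.sub_singleton_eq, hQ.spectrum_real_eq_range_eigenvalues] at ht
      obtain ⟨a, ⟨j, rfl⟩, b, hb, rfl⟩ := ht
      simp only [Set.mem_singleton_iff] at hb
      subst hb
      have := hi j
      simp only [Set.mem_ofPred_eq, sub_nonneg]
      exact this
  have hlow : ∀ x : V → ℝ, μ * (x ⬝ᵥ x) ≤ x ⬝ᵥ Q.mulVec x := by
    intro x
    have := hps.dotProduct_mulVec_nonneg x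
    rw [Matrix.sub_mulVec, Algebra.algebraMap_eq_smul_one, Matrix.smul_mulVec, Matrix.one_mulVec,
      dotProduct_sub, dotProduct_smul] at this
    simpa using this
  have hleast : IsLeast {μ : ℝ | ∃ x : V → ℝ, x ≠ 0 ∧ Q.mulVec x = μ • x} μ := by
    refine ⟨⟨⇑(hQ.eigenvectorBasis i), ?_, hQ.mulVec_eigenvectorBasis i⟩, ?_⟩
    · intro h0
      exact hQ.eigenvectorBasis.orthonormal.ne_zero i (by ext j; exact congrFun h0 j)
    · rintro ν ⟨x, hx, hν⟩
      have h := hlow x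
      rw [hν, dotProduct_smul, smul_eq_mul] at h
      have hpos : 0 < x ⬝ᵥ x := by
        have := Matrix.dotProduct_star_self_pos_iff.2 hx
        simpa using this
      exact le_of_mul_le_mul_right h hpos
  have hq : qMin G = μ := hleast.csInf_eq
  rw [hq]
  obtain ⟨x, hx, hν⟩ := hleast.1
  exact ⟨⟨x, hx, by rw [hν, dotProduct_smul, smul_eq_mul]⟩, hlow⟩

/-! ### The quadratic form of `U_n^k(g)` -/

/-- The quadratic form of `Q(U_n^k(g))` for `g = 2h + 1` and a path on `r + 1` vertices: one square
for each edge of the path through the vertices `0, …, 2h + r`, for the edge that closes the cycle,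
and for each edge of the star. -/
theorem form_unicyclicGraph {h r k : ℕ} (hh : 1 ≤ h) (X : ℕ → ℝ) :
    (fun i : Fin (2 * h + 1 + r + k) => X i) ⬝ᵥ
        (signlessLaplacian (unicyclicGraph (2 * h + 1 + r + k) (2 * h + 1) k)).mulVec
          (fun i => X i)
      = ∑ i ∈ range (2 * h + r), (X i + X (i + 1)) ^ 2 + (X 0 + X (2 * h)) ^ 2
        + ∑ j ∈ range k, (X (2 * h + r) + X (2 * h + r + 1 + j)) ^ 2 := by
  classical
  set n := 2 * h + 1 + r + k with hn
  set F : ℕ → ℕ → ℝ := fun i j => (X i + X j) ^ 2 with hF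
  set f₁ : ℕ → ℕ → ℝ := fun i j => if i + 1 = j ∧ j + k + 1 ≤ n then F i j else 0 with hf₁
  set f₂ : ℕ → ℕ → ℝ := fun i j => if i = 0 ∧ j + 1 = 2 * h + 1 then F i j else 0 with hf₂
  set f₃ : ℕ → ℕ → ℝ := fun i j => if i + k + 1 = n ∧ n ≤ j + k then F i j else 0 with hf₃
  -- the three kinds of edges exclude each other, and each of them has a direction
  have hind : ∀ i j : Fin n, (if (unicyclicGraph n (2 * h + 1) k).Adj i j then
      (X i + X j) ^ 2 else 0) = (f₁ i j + f₂ i j + f₃ i j) + (f₁ j i + f₂ j i + f₃ j i) := by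
    intro i j
    have hj := j.2
    have hi := i.2
    have hFs : F j i = F i j := by simp only [hF, add_comm]
    simp only [unicyclicGraph, SimpleGraph.fromRel_adj, hf₁, hf₂, hf₃, hFs, ne_eq, Fin.ext_iff]
    change (if _ then F i j else 0) = _
    by_cases c1 : (i : ℕ) + 1 = j ∧ (j : ℕ) + k + 1 ≤ n
    · rw [if_pos (by omega), if_pos c1, if_neg (by omega), if_neg (by omega), if_neg (by omega),
        if_neg (by omega), if_neg (by omega)]; ring
    by_cases c2 : (i : ℕ) = 0 ∧ (j : ℕ) + 1 = 2 * h + 1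
    · rw [if_pos (by omega), if_neg c1, if_pos c2, if_neg (by omega), if_neg (by omega),
        if_neg (by omega), if_neg (by omega)]; ring
    by_cases c3 : (i : ℕ) + k + 1 = n ∧ n ≤ (j : ℕ) + k
    · rw [if_pos (by omega), if_neg c1, if_neg c2, if_pos c3, if_neg (by omega),
        if_neg (by omega), if_neg (by omega)]; ring
    by_cases c4 : (j : ℕ) + 1 = i ∧ (i : ℕ) + k + 1 ≤ n
    · rw [if_pos (by omega), if_neg c1, if_neg c2, if_neg c3, if_pos c4,
        if_neg (by omega), if_neg (by omega)]; ring
    by_cases c5 : (j : ℕ) = 0 ∧ (i : ℕ) + 1 = 2 * h + 1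
    · rw [if_pos (by omega), if_neg c1, if_neg c2, if_neg c3, if_neg c4, if_pos c5,
        if_neg (by omega)]; ring
    by_cases c6 : (j : ℕ) + k + 1 = n ∧ n ≤ (i : ℕ) + k
    · rw [if_pos (by omega), if_neg c1, if_neg c2, if_neg c3, if_neg c4, if_neg c5, if_pos c6]
      ring
    · rw [if_neg c1, if_neg c2, if_neg c3, if_neg c4, if_neg c5, if_neg c6, if_neg]
      · ring
      · rintro ⟨-, (hc | hc | hc) | hc | hc | hc⟩
        exacts [c1 hc, c2 hc, c3 hc, c4 hc, c5 hc, c6 hc]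
  have htwo := dotProduct_signlessLaplacian (unicyclicGraph n (2 * h + 1) k)
    (fun i : Fin n => X i)
  simp only [hind] at htwo
  have hsymm : ∑ i : Fin n, ∑ j : Fin n, (f₁ j i + f₂ j i + f₃ j i)
      = ∑ i : Fin n, ∑ j : Fin n, (f₁ i j + f₂ i j + f₃ i j) := sum_comm
  have hnat : ∑ i : Fin n, ∑ j : Fin n, (f₁ i j + f₂ i j + f₃ i j)
      = ∑ i ∈ range n, ∑ j ∈ range n, (f₁ i j + f₂ i j + f₃ i j) := by
    rw [← Fin.sum_univ_eq_sum_range (fun i => ∑ j ∈ range n, (f₁ i j + f₂ i j + f₃ i j))]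
    refine sum_congr rfl fun i _ => ?_
    exact Fin.sum_univ_eq_sum_range (fun j => f₁ i j + f₂ i j + f₃ i j) n
  have h1 : ∑ i ∈ range n, ∑ j ∈ range n, f₁ i j
      = ∑ i ∈ range (2 * h + r), (X i + X (i + 1)) ^ 2 := by
    symm
    refine sum_subset_zero_on_sdiff (range_subset_range.2 (by omega)) ?_ ?_
    · intro i hi
      simp only [mem_sdiff, mem_range, not_lt] at hi
      exact sum_eq_zero fun j _ => if_neg (by omega)
    · intro i hi
      have hi := mem_range.1 hi
      rw [sum_eq_single (i + 1) (fun j _ hj => if_neg (by omega))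
        (fun hj => absurd (mem_range.2 (by omega)) hj)]
      exact (if_pos (by omega)).symm
  have h2 : ∑ i ∈ range n, ∑ j ∈ range n, f₂ i j = (X 0 + X (2 * h)) ^ 2 := by
    rw [sum_eq_single 0 (fun i _ hi => sum_eq_zero fun j _ => if_neg (by omega))
      (fun hi => absurd (mem_range.2 (by omega)) hi),
      sum_eq_single (2 * h) (fun j _ hj => if_neg (by omega))
      (fun hj => absurd (mem_range.2 (by omega)) hj)]
    exact if_pos (by omega)
  have h3 : ∑ i ∈ range n, ∑ j ∈ range n, f₃ i j
      = ∑ j ∈ range k, (X (2 * h + r) + X (2 * h + r + 1 + j)) ^ 2 := by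
    rw [sum_eq_single (2 * h + r) (fun i _ hi => sum_eq_zero fun j _ => if_neg (by omega))
      (fun hi => absurd (mem_range.2 (by omega)) hi),
      show range n = range (2 * h + r + 1 + k) by congr 1; omega, sum_range_add,
      sum_eq_zero (s := range (2 * h + r + 1)), zero_add]
    · exact sum_congr rfl fun j _ => if_pos (by omega)
    · intro j hj
      have := mem_range.1 hj
      exact if_neg (by omega)
  simp only [sum_add_distrib] at htwo hsymm hnat
  linarith

/-- The vector on the graph, with the signs that make all edges but the farthest edge of the cycle
look bipartite, whose values up to these signs are listed by `A`, from the end of that edge with the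
larger index through the branching vertex (position `h`) and the center of the star (position
`h + r`) to the leaves, and by `B`, from the other end of the edge to the other neighbor of the
branching vertex (position `h - 1`). All leaves carry the sign of the position `h + r + 1`. -/
def unfoldVec (h r : ℕ) (A B : ℕ → ℝ) (i : ℕ) : ℝ :=
  if i < h then (-1) ^ (h - 1 - i) * B (h - 1 - i)
  else (-1) ^ (min (i - h) (h + r + 1)) * A (i - h)

theorem unfoldVec_right (h r : ℕ) (A B : ℕ → ℝ) (p : ℕ) :
    unfoldVec h r A B (h + p) = (-1) ^ (min p (h + r + 1)) * A p := by
  rw [unfoldVec, if_neg (by omega), Nat.add_sub_cancel_left]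

theorem unfoldVec_left {h p : ℕ} (r : ℕ) (A B : ℕ → ℝ) (hp : p < h) :
    unfoldVec h r A B (h - 1 - p) = (-1) ^ p * B p := by
  rw [unfoldVec, if_pos (by omega), show h - 1 - (h - 1 - p) = p by omega]

theorem exists_eq_unfoldVec (h r : ℕ) (X : ℕ → ℝ) : ∃ A B : ℕ → ℝ, B h = A h ∧
    ∀ i, X i = unfoldVec h r A B i := by
  let A : ℕ → ℝ := fun p => (-1) ^ (min p (h + r + 1)) * X (h + p)
  refine ⟨A, fun p => if p < h then (-1) ^ p * X (h - 1 - p) else A p, if_neg (lt_irrefl h), ?_⟩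
  intro i
  by_cases hi : i < h
  · rw [unfoldVec, if_pos hi, if_pos (by omega), ← mul_assoc, ← mul_pow,
      show h - 1 - (h - 1 - i) = i by omega]
    norm_num
  · rw [unfoldVec, if_neg hi, ← mul_assoc, ← mul_pow, show h + (i - h) = i by omega]
    norm_num

theorem sq_neg_one_pow_mul_add (p : ℕ) (a b : ℝ) :
    ((-1) ^ p * a + (-1) ^ (p + 1) * b) ^ 2 = (b - a) ^ 2 := by
  have h : ((-1 : ℝ) ^ p) ^ 2 = 1 := by rw [← pow_mul, mul_comm, pow_mul]; norm_num
  calc ((-1) ^ p * a + (-1) ^ (p + 1) * b) ^ 2 = ((-1 : ℝ) ^ p) ^ 2 * (b - a) ^ 2 := by ring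
    _ = _ := by rw [h, one_mul]

theorem sq_neg_one_pow_mul (p : ℕ) (a : ℝ) : ((-1) ^ p * a) ^ 2 = a ^ 2 := by
  have := sq_neg_one_pow_mul_add p 0 a
  simpa [pow_succ] using this

theorem form_unfoldVec {h r k : ℕ} (hh : 1 ≤ h) {A B : ℕ → ℝ} (hAB : B h = A h) :
    (fun i : Fin (2 * h + 1 + r + k) => unfoldVec h r A B i) ⬝ᵥ
        (signlessLaplacian (unicyclicGraph (2 * h + 1 + r + k) (2 * h + 1) k)).mulVec
          (fun i => unfoldVec h r A B i)
      = (A 0 + B 0) ^ 2 + ∑ p ∈ range h, (A (p + 1) - A p) ^ 2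
        + ∑ p ∈ range h, (B (p + 1) - B p) ^ 2
        + ∑ p ∈ range r, (A (h + p + 1) - A (h + p)) ^ 2
        + ∑ j ∈ range k, (A (h + r + 1 + j) - A (h + r)) ^ 2 := by
  rw [form_unicyclicGraph hh (unfoldVec h r A B)]
  set X := unfoldVec h r A B
  obtain ⟨d, rfl⟩ : ∃ d, h = d + 1 := ⟨h - 1, by omega⟩
  have hR : ∀ p, X (d + 1 + p) = (-1) ^ (min p (d + 1 + r + 1)) * A p := unfoldVec_right _ _ _ _
  have hL : ∀ p, p < d + 1 → X (d - p) = (-1) ^ p * B p := fun p hp => unfoldVec_left r A B hp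
  have hstep : ∀ p, p < d + 1 + r → (X (d + 1 + p) + X (d + 1 + p + 1)) ^ 2
      = (A (p + 1) - A p) ^ 2 := by
    intro p hp
    rw [add_assoc (d + 1) p 1, hR, hR, min_eq_left (by omega), min_eq_left (by omega),
      sq_neg_one_pow_mul_add]
  have hsplit : ∑ i ∈ range (2 * (d + 1) + r), (X i + X (i + 1)) ^ 2
      = ∑ p ∈ range d, (B (p + 1) - B p) ^ 2 + (A 0 + B 0) ^ 2
        + (∑ p ∈ range (d + 1), (A (p + 1) - A p) ^ 2
          + ∑ p ∈ range r, (A (d + 1 + p + 1) - A (d + 1 + p)) ^ 2) := by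
    rw [show 2 * (d + 1) + r = d + 1 + (d + 1 + r) by omega, sum_range_add _ (d + 1),
      sum_range_succ, ← sum_range_reflect]
    congr 1
    · congr 1
      · refine sum_congr rfl fun p hp => ?_
        have hp := mem_range.1 hp
        rw [show d - 1 - p + 1 = d - p by omega, show d - 1 - p = d - (p + 1) by omega,
          hL _ (by omega), hL _ (by omega), add_comm, sq_neg_one_pow_mul_add]
      · have h0 := hL 0 (by omega)
        have h1 := hR 0
        simp only [Nat.sub_zero, add_zero, pow_zero, one_mul, Nat.zero_min] at h0 h1
        rw [h0, h1, add_comm]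
    · rw [← sum_range_add]
      exact sum_congr rfl fun p hp => hstep p (mem_range.1 hp)
  have hclose : (X 0 + X (2 * (d + 1))) ^ 2 = (B (d + 1) - B d) ^ 2 := by
    rw [show 0 = d - d by omega, hL d (by omega), show 2 * (d + 1) = d + 1 + (d + 1) by omega, hR,
      min_eq_left (by omega), sq_neg_one_pow_mul_add, hAB]
  have hstar : ∑ j ∈ range k, (X (2 * (d + 1) + r) + X (2 * (d + 1) + r + 1 + j)) ^ 2
      = ∑ j ∈ range k, (A (d + 1 + r + 1 + j) - A (d + 1 + r)) ^ 2 := by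
    refine sum_congr rfl fun j _ => ?_
    rw [show 2 * (d + 1) + r = d + 1 + (d + 1 + r) by omega, add_assoc (d + 1),
      add_assoc (d + 1), hR, hR, min_eq_left (by omega), min_eq_right (by omega),
      sq_neg_one_pow_mul_add]
  rw [hsplit, hclose, hstar, sum_range_succ (fun p => (B (p + 1) - B p) ^ 2)]
  ring

theorem norm_unfoldVec (h r k : ℕ) (A B : ℕ → ℝ) :
    (fun i : Fin (2 * h + 1 + r + k) => unfoldVec h r A B i) ⬝ᵥ (fun i => unfoldVec h r A B i)
      = ∑ p ∈ range h, A p ^ 2 + ∑ p ∈ range h, B p ^ 2 + ∑ p ∈ range (r + 1), A (h + p) ^ 2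
        + ∑ j ∈ range k, A (h + r + 1 + j) ^ 2 := by
  have h1 : (fun i : Fin (2 * h + 1 + r + k) => unfoldVec h r A B i) ⬝ᵥ
      (fun i => unfoldVec h r A B i)
      = ∑ i ∈ range (h + (h + (r + 1) + k)), unfoldVec h r A B i ^ 2 := by
    rw [show h + (h + (r + 1) + k) = 2 * h + 1 + r + k by omega,
      ← Fin.sum_univ_eq_sum_range (fun i => unfoldVec h r A B i ^ 2)]
    exact sum_congr rfl fun i _ => (sq _).symm
  rw [h1, sum_range_add, ← sum_range_reflect]
  have h2 : ∑ p ∈ range h, unfoldVec h r A B (h - 1 - p) ^ 2 = ∑ p ∈ range h, B p ^ 2 :=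
    sum_congr rfl fun p hp => by
      rw [unfoldVec_left r A B (mem_range.1 hp), sq_neg_one_pow_mul]
  simp only [unfoldVec_right, sq_neg_one_pow_mul]
  rw [h2, sum_range_add, sum_range_add]
  simp only [add_assoc]
  ring

/-! ### Symmetric and monotone minimizers -/

/-- The quadratic form of `Q(U_n^k(g))`, `g = 2h + 1`, at a vector that is symmetric about the axis
of the cycle, in terms of its values `y` up to the alternating signs of `unfoldVec`: position
`0` is either end of the edge of the cycle that is farthest from the star, position `h` is the
branching vertex, `h + r` is the center of the star, and `h + r + 1, …, h + r + k` are its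
leaves. -/
def foldedForm (h r k : ℕ) (y : ℕ → ℝ) : ℝ :=
  4 * y 0 ^ 2 + 2 * ∑ p ∈ range h, (y (p + 1) - y p) ^ 2
    + ∑ p ∈ range r, (y (h + p + 1) - y (h + p)) ^ 2
    + ∑ j ∈ range k, (y (h + r + 1 + j) - y (h + r)) ^ 2

/-- The squared length of the vector that `foldedForm` is about. -/
def foldedNorm (h r k : ℕ) (y : ℕ → ℝ) : ℝ :=
  2 * ∑ p ∈ range h, y p ^ 2 + ∑ p ∈ range (r + 1), y (h + p) ^ 2
    + ∑ j ∈ range k, y (h + r + 1 + j) ^ 2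

theorem foldedForm_nonneg (h r k : ℕ) (y : ℕ → ℝ) : 0 ≤ foldedForm h r k y := by
  unfold foldedForm
  have h1 := sum_nonneg fun p (_ : p ∈ range h) => sq_nonneg (y (p + 1) - y p)
  have h2 := sum_nonneg fun p (_ : p ∈ range r) => sq_nonneg (y (h + p + 1) - y (h + p))
  have h3 := sum_nonneg fun j (_ : j ∈ range k) => sq_nonneg (y (h + r + 1 + j) - y (h + r))
  positivity

theorem qMin_mul_foldedNorm_le {h : ℕ} (hh : 1 ≤ h) (r k : ℕ) (y : ℕ → ℝ) :
    qMin (unicyclicGraph (2 * h + 1 + r + k) (2 * h + 1) k) * foldedNorm h r k y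
      ≤ foldedForm h r k y := by
  have : Nonempty (Fin (2 * h + 1 + r + k)) := ⟨⟨0, by omega⟩⟩
  have hq := (qMin_spec (unicyclicGraph (2 * h + 1 + r + k) (2 * h + 1) k)).2
    fun i => unfoldVec h r y y i
  rw [form_unfoldVec hh rfl, norm_unfoldVec] at hq
  unfold foldedForm foldedNorm
  convert hq using 2 <;> ring

/-- A vector splits into a symmetric and an antisymmetric part. The latter vanishes off the cycle;
reversing it along each half of the cycle and extending it by a constant to the rest of the graph
gives a symmetric vector with the same form and at least the same length. -/
theorem exists_foldedForm_eq {h : ℕ} (hh : 1 ≤ h) (r : ℕ) {k : ℕ} (hk : 1 ≤ k) :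
    ∃ y : ℕ → ℝ, 0 < foldedNorm h r k y ∧ foldedForm h r k y =
      qMin (unicyclicGraph (2 * h + 1 + r + k) (2 * h + 1) k) * foldedNorm h r k y := by
  have : Nonempty (Fin (2 * h + 1 + r + k)) := ⟨⟨0, by omega⟩⟩
  obtain ⟨x, hx0, hx⟩ := (qMin_spec (unicyclicGraph (2 * h + 1 + r + k) (2 * h + 1) k)).1
  have hxpos : 0 < x ⬝ᵥ x := by simpa using Matrix.dotProduct_star_self_pos_iff.2 hx0
  obtain ⟨A, B, hBA, hX⟩ := exists_eq_unfoldVec h r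
    fun i => if hi : i < 2 * h + 1 + r + k then x ⟨i, hi⟩ else 0
  have hxu : x = fun i : Fin (2 * h + 1 + r + k) => unfoldVec h r A B i := by
    funext i
    rw [← hX i, dif_pos i.2]
  rw [hxu, norm_unfoldVec] at hxpos
  rw [hxu, form_unfoldVec hh hBA, norm_unfoldVec] at hx
  set q := qMin (unicyclicGraph (2 * h + 1 + r + k) (2 * h + 1) k)
  set s : ℕ → ℝ := fun p => if p < h then (A p + B p) / 2 else A p with hs
  set t : ℕ → ℝ := fun p => (A p - B p) / 2 with ht
  set t' : ℕ → ℝ := fun p => t (h - p) with ht'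
  have hth : t h = 0 := by simp only [ht, hBA, sub_self, zero_div]
  have hs1 : ∀ p, p ≤ h → s p = (A p + B p) / 2 := by
    intro p hp
    rcases hp.lt_or_eq with hp | rfl
    · exact if_pos hp
    · rw [hBA]
      simp only [hs, lt_irrefl, if_false]
      ring
  have hs2 : ∀ p, s (h + p) = A (h + p) := fun p => if_neg (by omega)
  have hform_t : foldedForm h r k t' = 2 * ∑ p ∈ range h, (t (p + 1) - t p) ^ 2 := by
    have h1 : ∑ p ∈ range h, (t' (p + 1) - t' p) ^ 2 = ∑ p ∈ range h, (t (p + 1) - t p) ^ 2 := by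
      rw [← sum_range_reflect]
      refine sum_congr rfl fun p hp => ?_
      have hp := mem_range.1 hp
      simp only [ht']
      rw [show h - (h - 1 - p + 1) = p by omega, show h - (h - 1 - p) = p + 1 by omega]
      ring
    have h2 : ∀ p, t' (h + p) = t 0 := fun p => by simp only [ht', Nat.sub_add_eq, Nat.sub_self,
      Nat.zero_sub]
    have h3 : t' 0 = 0 := by simp only [ht', Nat.sub_zero, hth]
    unfold foldedForm
    simp only [add_assoc h, h2]
    rw [h1, h3]
    simp
  have hnorm_t : 2 * ∑ p ∈ range h, t p ^ 2 ≤ foldedNorm h r k t' := by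
    have h1 : ∑ p ∈ range h, t' p ^ 2 + t 0 ^ 2 = ∑ p ∈ range h, t p ^ 2 := by
      have h0 : ∑ p ∈ range (h + 1), t p ^ 2 = ∑ p ∈ range h, t p ^ 2 := by
        rw [sum_range_succ, hth]
        ring
      rw [← h0, ← sum_range_reflect _ (h + 1), sum_range_succ]
      simp [ht']
    have h2 : ∀ p, t' (h + p) = t 0 := fun p => by simp only [ht', Nat.sub_add_eq, Nat.sub_self,
      Nat.zero_sub]
    unfold foldedNorm
    simp only [add_assoc h, h2, sum_const, card_range, nsmul_eq_mul]
    push_cast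
    have hk' : (1 : ℝ) ≤ k := by exact_mod_cast hk
    nlinarith [sq_nonneg (t 0), mul_nonneg (Nat.cast_nonneg (α := ℝ) r) (sq_nonneg (t 0)),
      mul_nonneg (sub_nonneg.2 hk') (sq_nonneg (t 0))]
  have hform : (A 0 + B 0) ^ 2 + ∑ p ∈ range h, (A (p + 1) - A p) ^ 2
        + ∑ p ∈ range h, (B (p + 1) - B p) ^ 2
        + ∑ p ∈ range r, (A (h + p + 1) - A (h + p)) ^ 2
        + ∑ j ∈ range k, (A (h + r + 1 + j) - A (h + r)) ^ 2
      = foldedForm h r k s + 2 * ∑ p ∈ range h, (t (p + 1) - t p) ^ 2 := by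
    have h1 : ∑ p ∈ range h, (A (p + 1) - A p) ^ 2 + ∑ p ∈ range h, (B (p + 1) - B p) ^ 2
        = 2 * ∑ p ∈ range h, (s (p + 1) - s p) ^ 2
          + 2 * ∑ p ∈ range h, (t (p + 1) - t p) ^ 2 := by
      rw [mul_sum, mul_sum, ← sum_add_distrib, ← sum_add_distrib]
      refine sum_congr rfl fun p hp => ?_
      have hp := mem_range.1 hp
      rw [hs1 _ hp, hs1 _ hp.le]
      simp only [ht]
      ring
    unfold foldedForm
    simp only [add_assoc h, hs2]
    rw [hs1 0 (Nat.zero_le _)]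
    linarith
  have hnorm : ∑ p ∈ range h, A p ^ 2 + ∑ p ∈ range h, B p ^ 2 + ∑ p ∈ range (r + 1), A (h + p) ^ 2
        + ∑ j ∈ range k, A (h + r + 1 + j) ^ 2
      = foldedNorm h r k s + 2 * ∑ p ∈ range h, t p ^ 2 := by
    have h1 : ∑ p ∈ range h, A p ^ 2 + ∑ p ∈ range h, B p ^ 2
        = 2 * ∑ p ∈ range h, s p ^ 2 + 2 * ∑ p ∈ range h, t p ^ 2 := by
      rw [mul_sum, mul_sum, ← sum_add_distrib, ← sum_add_distrib]
      refine sum_congr rfl fun p hp => ?_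
      rw [hs1 _ (mem_range.1 hp).le]
      simp only [ht]
      ring
    unfold foldedNorm
    simp only [add_assoc h, hs2]
    linarith
  have hqs := qMin_mul_foldedNorm_le hh r k s
  have hqt := qMin_mul_foldedNorm_le hh r k t'
  rw [hform, hnorm, ← hform_t] at hx
  rw [hnorm] at hxpos
  have hq0 : 0 ≤ q := by
    by_contra hq
    have := foldedForm_nonneg h r k s
    have := foldedForm_nonneg h r k t'
    nlinarith
  have hqn := mul_le_mul_of_nonneg_left hnorm_t hq0
  by_cases hpos : 0 < foldedNorm h r k s
  · exact ⟨s, hpos, by linarith⟩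
  · exact ⟨t', by linarith, by linarith⟩

theorem qMin_unicyclicGraph_nonneg {h : ℕ} (hh : 1 ≤ h) (r : ℕ) {k : ℕ} (hk : 1 ≤ k) :
    0 ≤ qMin (unicyclicGraph (2 * h + 1 + r + k) (2 * h + 1) k) := by
  obtain ⟨y, hpos, hy⟩ := exists_foldedForm_eq hh r hk
  have := foldedForm_nonneg h r k y
  by_contra hq
  nlinarith

/-- Passing to the running maximum of the absolute values decreases the form and increases the
length, so the least eigenvalue is attained at a vector that grows towards the leaves. -/
theorem exists_monotone_foldedForm_eq {h : ℕ} (hh : 1 ≤ h) (r : ℕ) {k : ℕ} (hk : 1 ≤ k) :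
    ∃ y : ℕ → ℝ, 0 ≤ y 0 ∧ (∀ p q, p ≤ q → q ≤ h + r → y p ≤ y q) ∧
      (∀ j, y (h + r) ≤ y (h + r + 1 + j)) ∧
      0 < foldedNorm h r k y ∧ foldedForm h r k y =
        qMin (unicyclicGraph (2 * h + 1 + r + k) (2 * h + 1) k) * foldedNorm h r k y := by
  obtain ⟨y, hpos, hy⟩ := exists_foldedForm_eq hh r hk
  have hq0 := qMin_unicyclicGraph_nonneg hh r hk
  set M := partialSups fun p => |y p| with hM
  set z : ℕ → ℝ := fun p => if p ≤ h + r then M p else max (M (h + r)) |y p| with hz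
  have hMz : ∀ p, p ≤ h + r → z p = M p := fun p hp => if_pos hp
  have hleaf : ∀ j, z (h + r + 1 + j) = max (M (h + r)) |y (h + r + 1 + j)| :=
    fun j => if_neg (by omega)
  have hM0 : M 0 = |y 0| := partialSups_zero _
  have hMs : ∀ p, M (p + 1) = max (M p) |y (p + 1)| := fun p => partialSups_add_one _ p
  have hyM : ∀ p, |y p| ≤ M p := fun p => le_partialSups (fun p => |y p|) p
  -- a value `max m |b|` is at most as far from `m` as `b` is from any `a` with `|a| ≤ m`
  have key : ∀ m a b : ℝ, |a| ≤ m → (max m |b| - m) ^ 2 ≤ (b - a) ^ 2 := by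
    intro m a b ham
    rw [← sq_abs (b - a)]
    refine pow_le_pow_left₀ (sub_nonneg.2 (le_max_left _ _)) ?_ 2
    rw [sub_le_iff_le_add]
    refine max_le (by linarith [abs_nonneg (b - a)]) ?_
    have := abs_sub_abs_le_abs_sub b a
    linarith
  have hform : foldedForm h r k z ≤ foldedForm h r k y := by
    unfold foldedForm
    have h0 : z 0 ^ 2 = y 0 ^ 2 := by rw [hMz 0 (Nat.zero_le _), hM0, sq_abs]
    have h1 : ∀ p, p + 1 ≤ h + r → (z (p + 1) - z p) ^ 2 ≤ (y (p + 1) - y p) ^ 2 := by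
      intro p hp
      rw [hMz _ hp, hMz p (by omega), hMs]
      exact key _ _ _ (hyM p)
    have h2 : ∀ j, (z (h + r + 1 + j) - z (h + r)) ^ 2 ≤ (y (h + r + 1 + j) - y (h + r)) ^ 2 := by
      intro j
      rw [hMz _ le_rfl, hleaf]
      exact key _ _ _ (hyM _)
    have e1 := sum_le_sum fun p (hp : p ∈ range h) => h1 p (by have := mem_range.1 hp; omega)
    have e2 := sum_le_sum fun p (hp : p ∈ range r) =>
      h1 (h + p) (by have := mem_range.1 hp; omega)
    have e3 := sum_le_sum fun j (_ : j ∈ range k) => h2 j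
    linarith
  have hnorm : foldedNorm h r k y ≤ foldedNorm h r k z := by
    have hle : ∀ p, y p ^ 2 ≤ z p ^ 2 := by
      intro p
      rw [← sq_abs (y p)]
      refine pow_le_pow_left₀ (abs_nonneg _) ?_ 2
      simp only [hz]
      split_ifs
      · exact hyM p
      · exact le_max_right _ _
    unfold foldedNorm
    have e1 := sum_le_sum fun p (_ : p ∈ range h) => hle p
    have e2 := sum_le_sum fun p (_ : p ∈ range (r + 1)) => hle (h + p)
    have e3 := sum_le_sum fun j (_ : j ∈ range k) => hle (h + r + 1 + j)
    linarith
  refine ⟨z, ?_, ?_, ?_, hpos.trans_le hnorm, le_antisymm ?_ (qMin_mul_foldedNorm_le hh r k z)⟩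
  · rw [hMz 0 (Nat.zero_le _), hM0]
    exact abs_nonneg _
  · intro p q hpq hq
    rw [hMz _ hq, hMz p (hpq.trans hq)]
    exact M.monotone hpq
  · intro j
    rw [hMz _ le_rfl, hleaf]
    exact le_max_left _ _
  · calc foldedForm h r k z ≤ foldedForm h r k y := hform
      _ = _ := hy
      _ ≤ _ := mul_le_mul_of_nonneg_left hnorm hq0

theorem qMin_unicyclicGraph_pos {h : ℕ} (hh : 1 ≤ h) (r : ℕ) {k : ℕ} (hk : 1 ≤ k) :
    0 < qMin (unicyclicGraph (2 * h + 1 + r + k) (2 * h + 1) k) := by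
  refine (qMin_unicyclicGraph_nonneg hh r hk).lt_of_ne fun h0 => ?_
  obtain ⟨y, hpos, hy⟩ := exists_foldedForm_eq hh r hk
  rw [← h0, zero_mul, foldedForm] at hy
  have n1 := sum_nonneg fun p (_ : p ∈ range h) => sq_nonneg (y (p + 1) - y p)
  have n2 := sum_nonneg fun p (_ : p ∈ range r) => sq_nonneg (y (h + p + 1) - y (h + p))
  have n3 := sum_nonneg fun j (_ : j ∈ range k) => sq_nonneg (y (h + r + 1 + j) - y (h + r))
  have n0 := sq_nonneg (y 0)
  have z1 := (sum_eq_zero_iff_of_nonneg fun p _ => sq_nonneg _).1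
    (show ∑ p ∈ range h, (y (p + 1) - y p) ^ 2 = 0 by linarith)
  have z2 := (sum_eq_zero_iff_of_nonneg fun p _ => sq_nonneg _).1
    (show ∑ p ∈ range r, (y (h + p + 1) - y (h + p)) ^ 2 = 0 by linarith)
  have z3 := (sum_eq_zero_iff_of_nonneg fun p _ => sq_nonneg _).1
    (show ∑ j ∈ range k, (y (h + r + 1 + j) - y (h + r)) ^ 2 = 0 by linarith)
  have z0 : y 0 = 0 := pow_eq_zero_iff two_ne_zero |>.1 (by linarith)
  have hcyc : ∀ p ≤ h, y p = 0 := by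
    intro p
    induction p with
    | zero => exact fun _ => z0
    | succ p ih =>
      intro hp
      have := pow_eq_zero_iff two_ne_zero |>.1 (z1 p (mem_range.2 hp))
      rw [ih (by omega)] at this
      linarith
  have hpath : ∀ p ≤ r, y (h + p) = 0 := by
    intro p
    induction p with
    | zero => exact fun _ => hcyc h le_rfl
    | succ p ih =>
      intro hp
      have := pow_eq_zero_iff two_ne_zero |>.1 (z2 p (mem_range.2 hp))
      rw [ih (by omega)] at this
      rw [← add_assoc]
      linarith
  refine hpos.ne' ?_
  unfold foldedNorm
  rw [sum_eq_zero fun p hp => ?_, sum_eq_zero fun p hp => ?_, sum_eq_zero fun j hj => ?_]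
  · norm_num
  · have := pow_eq_zero_iff two_ne_zero |>.1 (z3 j hj)
    rw [hpath r le_rfl, sub_zero] at this
    rw [this, zero_pow two_ne_zero]
  · rw [hpath p (by have := mem_range.1 hp; omega), zero_pow two_ne_zero]
  · rw [hcyc p (mem_range.1 hp).le, zero_pow two_ne_zero]

/-- A monotone minimizer increases strictly on the edges of the cycle at the branching vertex:
otherwise raising it by a small constant from the branching vertex onwards would lower the Rayleigh
quotient. -/
theorem lt_of_foldedForm_eq {h r k : ℕ} (hk : 1 ≤ k) {y : ℕ → ℝ} (h0 : 0 ≤ y 0)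
    (hmono : ∀ p q, p ≤ q → q ≤ h + 1 + r → y p ≤ y q)
    (hleaf : ∀ j, y (h + 1 + r) ≤ y (h + 1 + r + 1 + j)) (hpos : 0 < foldedNorm (h + 1) r k y)
    (hy : foldedForm (h + 1) r k y =
      qMin (unicyclicGraph (2 * (h + 1) + 1 + r + k) (2 * (h + 1) + 1) k)
        * foldedNorm (h + 1) r k y) : y h < y (h + 1) := by
  have hq0 := qMin_unicyclicGraph_pos (h := h + 1) (by omega) r hk
  have hmin := qMin_mul_foldedNorm_le (h := h + 1) (by omega) r k
  set q := qMin (unicyclicGraph (2 * (h + 1) + 1 + r + k) (2 * (h + 1) + 1) k)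
  by_contra hlt
  have heq : y h = y (h + 1) := le_antisymm (hmono _ _ (by omega) (by omega)) (not_lt.1 hlt)
  have hnn : ∀ p ≤ h + 1 + r, 0 ≤ y p := fun p hp => h0.trans (hmono _ _ (Nat.zero_le _) hp)
  have hnl : ∀ j, 0 ≤ y (h + 1 + r + 1 + j) := fun j => (hnn _ le_rfl).trans (hleaf j)
  have hnp : ∀ p ∈ range (r + 1), 0 ≤ y (h + 1 + p) :=
    fun p hp => hnn _ (by have := mem_range.1 hp; omega)
  set T := ∑ p ∈ range (r + 1), y (h + 1 + p) + ∑ j ∈ range k, y (h + 1 + r + 1 + j) with hT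
  have hT0 : 0 < T := by
    have n1 := sum_nonneg hnp
    have n2 := sum_nonneg fun j (_ : j ∈ range k) => hnl j
    refine (add_nonneg n1 n2).lt_of_ne fun hT0 => hpos.ne' ?_
    have z1 := (sum_eq_zero_iff_of_nonneg hnp).1 (by linarith)
    have z2 := (sum_eq_zero_iff_of_nonneg fun j (_ : j ∈ range k) => hnl j).1 (by linarith)
    have z0 : ∀ p ∈ range (h + 1), y p = 0 := by
      intro p hp
      have hp := mem_range.1 hp
      have h1 : y (h + 1) = 0 := z1 0 (mem_range.2 (by omega))
      exact le_antisymm (h1 ▸ hmono _ _ hp.le (by omega)) (hnn p (by omega))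
    unfold foldedNorm
    rw [sum_eq_zero fun p hp => ?_, sum_eq_zero fun p hp => ?_, sum_eq_zero fun j hj => ?_]
    · norm_num
    · rw [z2 j hj, zero_pow two_ne_zero]
    · rw [z1 p hp, zero_pow two_ne_zero]
    · rw [z0 p hp, zero_pow two_ne_zero]
  -- the form grows by `2 ε ^ 2` and the squared length by at least `2 ε T`
  set ε := q * T / 2 with hε
  have hε0 : 0 < ε := by positivity
  set z : ℕ → ℝ := fun p => if p ≤ h then y p else y p + ε with hz
  have hz1 : ∀ p ≤ h, z p = y p := fun p hp => if_pos hp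
  have hz2 : ∀ p, z (h + 1 + p) = y (h + 1 + p) + ε := fun p => if_neg (by omega)
  have hform : foldedForm (h + 1) r k z = foldedForm (h + 1) r k y + 2 * ε ^ 2 := by
    have e1 : ∑ p ∈ range h, (z (p + 1) - z p) ^ 2 = ∑ p ∈ range h, (y (p + 1) - y p) ^ 2 :=
      sum_congr rfl fun p hp => by
        have hp := mem_range.1 hp
        rw [hz1 _ hp, hz1 _ hp.le]
    have e2 : z (h + 1) = y (h + 1) + ε := hz2 0
    unfold foldedForm
    rw [sum_range_succ _ h, sum_range_succ _ h, e1, e2, hz1 0 (Nat.zero_le _), hz1 h le_rfl, heq]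
    simp only [add_assoc (h + 1), hz2, add_sub_add_right_eq_sub]
    ring
  have hnorm : foldedNorm (h + 1) r k y + 2 * ε * T ≤ foldedNorm (h + 1) r k z := by
    have e1 : ∑ p ∈ range (h + 1), z p ^ 2 = ∑ p ∈ range (h + 1), y p ^ 2 :=
      sum_congr rfl fun p hp => by rw [hz1 _ (Nat.lt_succ_iff.1 (mem_range.1 hp))]
    have e2 : ∀ (s : Finset ℕ) (f : ℕ → ℝ),
        ∑ p ∈ s, f p ^ 2 + 2 * ε * ∑ p ∈ s, f p ≤ ∑ p ∈ s, (f p + ε) ^ 2 := by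
      intro s f
      rw [mul_sum, ← sum_add_distrib]
      exact sum_le_sum fun p _ => by nlinarith [sq_nonneg ε]
    have e3 := e2 (range (r + 1)) fun p => y (h + 1 + p)
    have e4 := e2 (range k) fun j => y (h + 1 + r + 1 + j)
    unfold foldedNorm
    rw [e1, hT]
    simp only [add_assoc (h + 1), hz2] at e3 e4 ⊢
    linarith
  have h1 := hmin z
  rw [hform, hy] at h1
  have h2 := mul_le_mul_of_nonneg_left hnorm hq0.le
  have h3 : q * T ≤ ε := by
    have : ε * (q * T) ≤ ε * ε := by linarith
    exact le_of_mul_le_mul_left this hε0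
  have h4 : 0 < q * T := mul_pos hq0 hT0
  linarith

/-! ### Comparing the least eigenvalues of two graphs -/

/-- Moving the leaves of the star to one of them, which becomes the new center, does not increase
the least eigenvalue. -/
theorem qMin_unicyclicGraph_le_succ {n g k : ℕ} (hodd : Odd g) (hg : 3 ≤ g) (hk : 1 ≤ k)
    (hn : g + (k + 1) ≤ n) :
    qMin (unicyclicGraph n g k) ≤ qMin (unicyclicGraph n g (k + 1)) := by
  obtain ⟨h, rfl⟩ := hodd
  obtain ⟨r, rfl⟩ : ∃ r, n = 2 * h + 1 + r + (k + 1) := ⟨n - (2 * h + 1 + (k + 1)), by omega⟩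
  obtain ⟨y, h0, hmono, hleaf, hpos, hy⟩ :=
    exists_monotone_foldedForm_eq (h := h) (by omega) r (k := k + 1) (by omega)
  have hnn : ∀ j, 0 ≤ y (h + r + 1 + j) :=
    fun j => (h0.trans (hmono 0 (h + r) (Nat.zero_le _) le_rfl)).trans (hleaf j)
  set c := h + r + 1 with hc
  set z : ℕ → ℝ := fun p => if p ≤ c then y p else max (y p) (y c) with hz
  have hz1 : ∀ p ≤ c, z p = y p := fun p hp => if_pos hp
  have hz2 : ∀ j, z (c + (j + 1)) = max (y (c + (j + 1))) (y c) := fun j => if_neg (by omega)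
  have hmin := qMin_mul_foldedNorm_le (h := h) (by omega) (r + 1) k z
  rw [show 2 * h + 1 + (r + 1) + k = 2 * h + 1 + r + (k + 1) by omega] at hmin
  have e1 : ∑ p ∈ range h, (z (p + 1) - z p) ^ 2 = ∑ p ∈ range h, (y (p + 1) - y p) ^ 2 :=
    sum_congr rfl fun p hp => by
      have hp := mem_range.1 hp
      rw [hz1 _ (by omega), hz1 _ (by omega)]
  have e2 : ∑ p ∈ range (r + 1), (z (h + p + 1) - z (h + p)) ^ 2
      = ∑ p ∈ range (r + 1), (y (h + p + 1) - y (h + p)) ^ 2 :=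
    sum_congr rfl fun p hp => by
      have hp := mem_range.1 hp
      rw [hz1 _ (by omega), hz1 _ (by omega)]
  have e3 : ∑ j ∈ range k, (z (h + (r + 1) + 1 + j) - z (h + (r + 1))) ^ 2
      ≤ ∑ j ∈ range k, (y (c + (j + 1)) - y (h + r)) ^ 2 := by
    refine sum_le_sum fun j _ => ?_
    rw [show h + (r + 1) + 1 + j = c + (j + 1) by omega, show h + (r + 1) = c by omega, hz2,
      hz1 c le_rfl]
    have l1 := hleaf 0
    have l2 := hleaf (j + 1)
    rw [add_zero] at l1
    refine pow_le_pow_left₀ (sub_nonneg.2 (le_max_right _ _)) ?_ 2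
    rw [sub_le_iff_le_add]
    exact max_le (by linarith) (by linarith)
  have hform : foldedForm h (r + 1) k z ≤ foldedForm h r (k + 1) y := by
    unfold foldedForm
    rw [e1, e2, hz1 0 (Nat.zero_le _), sum_range_succ _ r, ← hc, sum_range_succ' _ k, add_zero]
    linarith
  have f1 : ∑ p ∈ range h, z p ^ 2 = ∑ p ∈ range h, y p ^ 2 :=
    sum_congr rfl fun p hp => by
      have hp := mem_range.1 hp
      rw [hz1 _ (by omega)]
  have f2 : ∑ p ∈ range (r + 1 + 1), z (h + p) ^ 2 = ∑ p ∈ range (r + 1 + 1), y (h + p) ^ 2 :=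
    sum_congr rfl fun p hp => by
      have hp := mem_range.1 hp
      rw [hz1 _ (by omega)]
  have f3 : ∑ j ∈ range k, y (c + (j + 1)) ^ 2 ≤ ∑ j ∈ range k, z (h + (r + 1) + 1 + j) ^ 2 := by
    refine sum_le_sum fun j _ => ?_
    rw [show h + (r + 1) + 1 + j = c + (j + 1) by omega, hz2]
    exact pow_le_pow_left₀ (hnn _) (le_max_left _ _) 2
  have hnorm : foldedNorm h r (k + 1) y ≤ foldedNorm h (r + 1) k z := by
    unfold foldedNorm
    rw [f1, f2, sum_range_succ _ (r + 1), ← hc, sum_range_succ' _ k, add_zero,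
      show y (h + (r + 1)) = y c from rfl]
    linarith
  have hz0 : 0 < foldedNorm h (r + 1) k z := hpos.trans_le hnorm
  have hq0 := qMin_unicyclicGraph_nonneg (h := h) (by omega) r (k := k + 1) (by omega)
  refine le_of_mul_le_mul_right ?_ hz0
  calc _ ≤ _ := hmin
    _ ≤ _ := hform
    _ = _ := hy
    _ ≤ _ := mul_le_mul_of_nonneg_left hnorm hq0

/-- Identifying the two neighbors of the branching vertex on the cycle shortens the cycle by two
vertices and lengthens the path by one; the vertex that is saved becomes a new leaf. With the value
of the center at the new leaf, the form loses the square of one edge, and the length does not drop,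
since the minimizer grows towards the center. -/
theorem qMin_unicyclicGraph_succ_lt {n g k : ℕ} (hodd : Odd g) (hg : 3 ≤ g) (hk : 1 ≤ k)
    (hn : g + 2 + k ≤ n) :
    qMin (unicyclicGraph n g (k + 1)) < qMin (unicyclicGraph n (g + 2) k) := by
  obtain ⟨h, rfl⟩ := hodd
  rw [show 2 * h + 1 + 2 = 2 * (h + 1) + 1 by ring] at hn ⊢
  obtain ⟨r, rfl⟩ : ∃ r, n = 2 * (h + 1) + 1 + r + k := ⟨n - (2 * (h + 1) + 1 + k), by omega⟩
  obtain ⟨y, h0, hmono, hleaf, hpos, hy⟩ :=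
    exists_monotone_foldedForm_eq (h := h + 1) (by omega) r hk
  have hlt := lt_of_foldedForm_eq hk h0 hmono hleaf hpos hy
  set z : ℕ → ℝ := fun p => if p = h + r + 2 + k then y (h + 1 + r) else y p with hz
  have hz1 : ∀ p, p ≠ h + r + 2 + k → z p = y p := fun p hp => if_neg hp
  have hz2 : z (h + (r + 1) + 1 + k) = y (h + 1 + r) := if_pos (by omega)
  have hmin := qMin_mul_foldedNorm_le (h := h) (by omega) (r + 1) (k + 1) z
  rw [show 2 * h + 1 + (r + 1) + (k + 1) = 2 * (h + 1) + 1 + r + k by omega] at hmin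
  have e1 : ∑ p ∈ range h, (z (p + 1) - z p) ^ 2 = ∑ p ∈ range h, (y (p + 1) - y p) ^ 2 :=
    sum_congr rfl fun p hp => by
      have hp := mem_range.1 hp
      rw [hz1 _ (by omega), hz1 _ (by omega)]
  have e2 : ∑ p ∈ range (r + 1), (z (h + p + 1) - z (h + p)) ^ 2
      = ∑ p ∈ range r, (y (h + 1 + p + 1) - y (h + 1 + p)) ^ 2 + (y (h + 1) - y h) ^ 2 := by
    rw [sum_range_succ']
    congr 1
    · refine sum_congr rfl fun p hp => ?_
      have hp := mem_range.1 hp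
      rw [hz1 _ (by omega), hz1 _ (by omega), show h + (p + 1) = h + 1 + p by omega]
    · rw [hz1 _ (by omega), hz1 _ (by omega), add_zero]
  have e3 : ∑ j ∈ range (k + 1), (z (h + (r + 1) + 1 + j) - z (h + (r + 1))) ^ 2
      = ∑ j ∈ range k, (y (h + 1 + r + 1 + j) - y (h + 1 + r)) ^ 2 := by
    rw [sum_range_succ, hz2, hz1 _ (by omega), show h + (r + 1) = h + 1 + r by omega, sub_self,
      zero_pow two_ne_zero, add_zero]
    refine sum_congr rfl fun j hj => ?_
    have hj := mem_range.1 hj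
    rw [hz1 _ (by omega)]
  have hform : foldedForm h (r + 1) (k + 1) z < foldedForm (h + 1) r k y := by
    unfold foldedForm
    rw [e1, e2, e3, hz1 0 (by omega), sum_range_succ _ h]
    have := pow_pos (sub_pos.2 hlt) 2
    linarith
  have f1 : ∑ p ∈ range h, z p ^ 2 = ∑ p ∈ range h, y p ^ 2 :=
    sum_congr rfl fun p hp => by
      have hp := mem_range.1 hp
      rw [hz1 _ (by omega)]
  have f2 : ∑ p ∈ range (r + 1 + 1), z (h + p) ^ 2
      = ∑ p ∈ range (r + 1), y (h + 1 + p) ^ 2 + y h ^ 2 := by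
    rw [sum_range_succ']
    congr 1
    · refine sum_congr rfl fun p hp => ?_
      have hp := mem_range.1 hp
      rw [hz1 _ (by omega), show h + (p + 1) = h + 1 + p by omega]
    · rw [hz1 _ (by omega), add_zero]
  have f3 : ∑ j ∈ range (k + 1), z (h + (r + 1) + 1 + j) ^ 2
      = ∑ j ∈ range k, y (h + 1 + r + 1 + j) ^ 2 + y (h + 1 + r) ^ 2 := by
    rw [sum_range_succ, hz2]
    congr 1
    refine sum_congr rfl fun j hj => ?_
    have hj := mem_range.1 hj
    rw [hz1 _ (by omega), show h + (r + 1) = h + 1 + r by omega]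
  have hnorm : foldedNorm (h + 1) r k y ≤ foldedNorm h (r + 1) (k + 1) z := by
    unfold foldedNorm
    rw [f1, f2, f3, sum_range_succ _ h]
    have := pow_le_pow_left₀ (h0.trans (hmono 0 h (Nat.zero_le _) (by omega)))
      (hmono h (h + 1 + r) (by omega) le_rfl) 2
    linarith
  have hz0 : 0 < foldedNorm h (r + 1) (k + 1) z := hpos.trans_le hnorm
  have hq0 := qMin_unicyclicGraph_nonneg (h := h + 1) (by omega) r hk
  refine lt_of_mul_lt_mul_right ?_ hz0.le
  calc _ ≤ _ := hmin
    _ < _ := hform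
    _ = _ := hy
    _ ≤ _ := mul_le_mul_of_nonneg_left hnorm hq0

theorem qMin_unicyclicGraph_le {n g k k' : ℕ} (hodd : Odd g) (hg : 3 ≤ g) (hk : 1 ≤ k)
    (hkk' : k ≤ k') (hn : g + k' ≤ n) :
    qMin (unicyclicGraph n g k) ≤ qMin (unicyclicGraph n g k') := by
  induction k', hkk' using Nat.le_induction with
  | base => exact le_rfl
  | succ k' hkk' ih =>
    exact (ih (by omega)).trans (qMin_unicyclicGraph_le_succ hodd hg (by omega) hn)

theorem qMin_unicyclicGraph_add_lt {n g k d : ℕ} (hodd : Odd g) (hg : 3 ≤ g) (hk : 1 ≤ k)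
    (hd : 1 ≤ d) (hn : g + 2 * d + k ≤ n) :
    qMin (unicyclicGraph n g (k + d)) < qMin (unicyclicGraph n (g + 2 * d) k) := by
  induction d, hd using Nat.le_induction generalizing k with
  | base => exact qMin_unicyclicGraph_succ_lt hodd hg hk hn
  | succ d hd ih =>
    have h1 := ih (k := k + 1) (by omega) (by omega)
    have h2 := qMin_unicyclicGraph_succ_lt (n := n) (g := g + 2 * d) (k := k)
      (hodd.add_even (even_two_mul d)) (by omega) hk (by omega)
    rw [show k + (d + 1) = k + 1 + d by omega, show g + 2 * (d + 1) = g + 2 * d + 2 by omega]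
    exact h1.trans h2

end LeastQ

theorem mainTheorem5 (n γ : ℕ) :
    (∀ g ∈ LeastQ.admissibleGirths n γ, (LeastQ.pendantCounts n γ g).Nonempty) ∧
    StrictMonoOn (fun g : ℕ => LeastQ.qMin (LeastQ.minUnicyclicGraph n γ g))
      (LeastQ.admissibleGirths n γ) := by
  refine ⟨fun g hg => LeastQ.pendantCounts_nonempty hg, ?_⟩
  intro g₁ h₁ g₂ h₂ hlt
  have hle := LeastQ.sInf_pendantCounts_le h₁ h₂ hlt
  have hk₁ := (Nat.sInf_mem (LeastQ.pendantCounts_nonempty h₁)).1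
  obtain ⟨hk₂, hn₂, -⟩ := Nat.sInf_mem (LeastQ.pendantCounts_nonempty h₂)
  obtain ⟨d, rfl⟩ : ∃ d, g₂ = g₁ + 2 * d := by
    obtain ⟨a, ha⟩ := h₁.1
    obtain ⟨b, hb⟩ := h₂.1
    exact ⟨b - a, by omega⟩
  calc LeastQ.qMin (LeastQ.minUnicyclicGraph n γ g₁)
      ≤ LeastQ.qMin (LeastQ.unicyclicGraph n g₁
          (sInf (LeastQ.pendantCounts n γ (g₁ + 2 * d)) + d)) :=
        LeastQ.qMin_unicyclicGraph_le h₁.1 h₁.2.1 hk₁ (by omega) (by omega)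
    _ < _ := LeastQ.qMin_unicyclicGraph_add_lt h₁.1 h₁.2.1 hk₂ (by omega) hn₂
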